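/- For every $\epsilon\in[0,1/2)$ there is a constant $c>0$, depending only on $\epsilon$, such that for every $n$ and every read-once Boolean function $f:\{0,1\}^n\to\{0,1\}$ one has $Q_\epsilon(f)\ge c\sqrt n$. Here $f$ is read-once if it is computed by a propositional formula built from the variables $x_1,\dots,x_n$ with NOT, AND and OR (and no constants) in which each of the $n$ variables occurs exactly once. A $t$-query quantum algorithm consists of a nonempty set $Z$ of values of the auxiliary memory with a start value $z_0\in Z$, unitary operators $U_1,\dots,U_t$ on the Hilbert space $H_W=\ell^2(\{0,\dots,n\}\times Z)$ with standard basis $|i,z\rangle$, and orthogonal projectors $P_0,P_1$ on $H_W$ with $P_0+P_1=I$. With $x_0:=0$ and the oracle $O_x|i,z\rangle=(-1)^{x_i}|i,z\rangle$, the final state on input $x$ is $|\Psi_x\rangle=O_xU_t\cdots O_xU_1|0,z_0\rangle$, and the algorithm outputs $b$ with probability $\|P_b|\Psi_x\rangle\|^2$. It $\epsilon$-computes $f$ if on every input $x$ the probability of the wrong answer $1-f(x)$ is at most $\epsilon$, and $Q_\epsilon(f)$ is the least $t$ for which some $t$-query algorithm $\epsilon$-computes $f$. -/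

import Mathlib

open scoped ENNReal

universe u

namespace ReadOnce

/-- Propositional formulas in the variables `x 0, ..., x (n - 1)`, without constants. -/
inductive Formula (n : ℕ) : Type
  | var (i : Fin n) : Formula n
  | not (φ : Formula n) : Formula n
  | and (φ ψ : Formula n) : Formula n
  | or (φ ψ : Formula n) : Formula n

/-- The value of a formula on an input. -/
def Formula.eval {n : ℕ} (x : Fin n → Bool) : Formula n → Bool
  | .var i => x i
  | .not φ => !(φ.eval x)
  | .and φ ψ => φ.eval x && ψ.eval x
  | .or φ ψ => φ.eval x || ψ.eval x

/-- The number of occurrences of the variable `i` in a formula. -/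
def Formula.occurrences {n : ℕ} (i : Fin n) : Formula n → ℕ
  | .var j => if j = i then 1 else 0
  | .not φ => φ.occurrences i
  | .and φ ψ => φ.occurrences i + ψ.occurrences i
  | .or φ ψ => φ.occurrences i + ψ.occurrences i

/-- A Boolean function of `n` variables is read-once if it is computed by a propositional
formula in which each of the `n` variables occurs exactly once. -/
def IsReadOnce {n : ℕ} (f : (Fin n → Bool) → Bool) : Prop :=
  ∃ φ : Formula n, (∀ i, φ.occurrences i = 1) ∧ ∀ x, φ.eval x = f x

end ReadOnce

namespace QuantumQuery

noncomputable section

/-- The space of the working memory: the query register, with the values `0, ..., n`, and an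
auxiliary memory with the arbitrary value set `Z`. A vector `ψ` has the coordinates `ψ i z`, and
the norm is the square root of the sum of all `‖ψ i z‖ ^ 2`. -/
abbrev WorkSpace (n : ℕ) (Z : Type u) : Type u :=
  PiLp 2 (fun _ : Fin (n + 1) => lp (fun _ : Z => ℂ) 2)

/-- The basis state with query register `i` and auxiliary memory `z`. -/
def basisState (n : ℕ) {Z : Type u} (i : Fin (n + 1)) (z : Z) : WorkSpace n Z :=
  open Classical in PiLp.single 2 i (lp.single 2 z (1 : ℂ))

/-- The input string with the additional bit `0` in position `0`. -/
def paddedInput {n : ℕ} (x : Fin n → Bool) : Fin (n + 1) → Bool :=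
  Fin.cons false x

/-- The action of the oracle on the work space when the input register holds `x`:
the sign of the coordinates at query value `i` changes exactly if the bit `i` is `1`. -/
def oracle {n : ℕ} (Z : Type u) (x : Fin n → Bool) : WorkSpace n Z ≃ₗᵢ[ℂ] WorkSpace n Z :=
  LinearIsometryEquiv.piLpCongrRight 2 fun i =>
    if paddedInput x i then LinearIsometryEquiv.neg ℂ else LinearIsometryEquiv.refl ℂ _

theorem oracle_apply {n : ℕ} (Z : Type u) (x : Fin n → Bool) (ψ : WorkSpace n Z)
    (i : Fin (n + 1)) :
    oracle Z x ψ i = (-1 : ℂ) ^ (paddedInput x i).toNat • ψ i := by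
  cases h : paddedInput x i <;> simp [oracle, h]

/-- A quantum query algorithm on `n`-bit inputs that makes `t` queries: a value set for the
auxiliary memory with a start value, the unitary work space operators that precede the queries,
and a pair of orthogonal projectors that sum to the identity. -/
structure Algorithm (n t : ℕ) : Type (u + 1) where
  Z : Type u
  start : Z
  U : Fin t → (WorkSpace n Z ≃ₗᵢ[ℂ] WorkSpace n Z)
  P : Bool → (WorkSpace n Z →L[ℂ] WorkSpace n Z)
  isStarProjection_P : ∀ b, IsStarProjection (P b)
  P_false_add_P_true : P false + P true = 1

/-- The state of the working memory on input `x` after `l` steps. The input register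
always holds `x`, so that the state of the whole memory is `|x⟩ ⊗ (A.state x l)`. -/
def Algorithm.state {n t : ℕ} (A : Algorithm.{u} n t) (x : Fin n → Bool) :
    Fin (t + 1) → WorkSpace n A.Z :=
  Fin.induction (basisState n 0 A.start) fun l ψ => oracle A.Z x (A.U l ψ)

/-- The probability that the algorithm outputs `b` on input `x`. -/
def Algorithm.outputProb {n t : ℕ} (A : Algorithm.{u} n t) (x : Fin n → Bool) (b : Bool) : ℝ :=
  ‖A.P b (A.state x (Fin.last t))‖ ^ 2

/-- On every input, the probability of the wrong answer is at most `ε`. -/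
def Algorithm.Computes {n t : ℕ} (A : Algorithm.{u} n t) (ε : ℝ)
    (f : (Fin n → Bool) → Bool) : Prop :=
  ∀ x, A.outputProb x (!f x) ≤ ε

/-- The `ε`-error quantum query complexity of `f`: the least number of queries of an algorithm
that `ε`-computes `f`. -/
def complexity {n : ℕ} (ε : ℝ) (f : (Fin n → Bool) → Bool) : ℕ∞ :=
  ⨅ (t : ℕ) (_ : ∃ A : Algorithm.{u} n t, A.Computes ε f), (t : ℕ∞)

end

end QuantumQuery

/-! The proof is an adversary argument. A nonnegative weight `w` on the cube, with norm 1 on each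
level set of `f`, is chosen so that the sum of `w x * w y` over ordered sensitive edges is `2√n`.
Such weights exist by induction on the formula: a variable has the constant weight 1, negation swaps
the level sets, and for a conjunction a rescaled product weight adds the squares of the edge sums
(`IsSensitivityWeight.and`). Weight the inner products of the states at the two ends of each edge in
the same way. The total starts at `2√n`, since all states agree; a query lowers it by at most 4
(`progress_sub_le_progress_oracle`); at the end it is at most `2√n (1 - δ)` with `δ = (√(1-ε) -
√ε)²`, since the outputs must differ across each edge. Hence `4t ≥ 2δ√n`. -/

namespace ReadOnce

/-! ### Sensitivity weights and their composition -/

section Sensitivity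

variable {V W : Type*} [DecidableEq V] [DecidableEq W]

/-- The input `x` with the bit `i` negated. -/
def flipBit (i : V) (x : V → Bool) : V → Bool :=
  Function.update x i (!x i)

theorem flipBit_flipBit (i : V) (x : V → Bool) : flipBit i (flipBit i x) = x := by
  simp [flipBit]

theorem flipBit_comp_equiv (e : V ≃ W) (i : V) (x : W → Bool) :
    flipBit i (x ∘ e) = flipBit (e i) x ∘ e := by
  ext j
  by_cases h : j = i
  · subst h; simp [flipBit]
  · simp [flipBit, h]

theorem flipBit_inl_elim (i : V) (s : V → Bool) (t : W → Bool) :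
    flipBit (Sum.inl i) (Sum.elim s t) = Sum.elim (flipBit i s) t := by
  exact Sum.update_elim_inl

theorem flipBit_inr_elim (i : W) (s : V → Bool) (t : W → Bool) :
    flipBit (Sum.inr i) (Sum.elim s t) = Sum.elim s (flipBit i t) := by
  exact Sum.update_elim_inr

variable [Fintype V] [Fintype W]

/-- A weighting of the cube that is normalized on both level sets of `f` and witnesses that the
adjacency matrix of the sensitivity graph of `f` has norm at least the square root of the number
of variables. -/
structure IsSensitivityWeight (f : (V → Bool) → Bool) (w : (V → Bool) → ℝ) : Prop where
  nonneg : ∀ x, 0 ≤ w x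
  sum_sq : ∀ b, ∑ x, (if f x = b then w x ^ 2 else 0) = 1
  sum_sensitive : ∑ x, ∑ i, (if f x ≠ f (flipBit i x) then w x * w (flipBit i x) else 0) =
    2 * √(Fintype.card V)

theorem IsSensitivityWeight.sum_sq_univ {f : (V → Bool) → Bool} {w : (V → Bool) → ℝ}
    (h : IsSensitivityWeight f w) : ∑ x, w x ^ 2 = 2 := by
  have := congr_arg₂ (· + ·) (h.sum_sq true) (h.sum_sq false)
  simp only [← Finset.sum_add_distrib] at this
  rw [show (2 : ℝ) = 1 + 1 by norm_num, ← this]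
  exact Finset.sum_congr rfl fun x _ => by cases f x <;> simp

theorem isSensitivityWeight_proj [Unique V] :
    IsSensitivityWeight (fun x : V → Bool => x default) fun _ => 1 where
  nonneg _ := zero_le_one
  sum_sq b := by
    rw [← (Equiv.funUnique V Bool).symm.sum_comp]
    cases b <;> simp
  sum_sensitive := by
    simp [flipBit]

theorem IsSensitivityWeight.not {f : (V → Bool) → Bool} {w : (V → Bool) → ℝ}
    (h : IsSensitivityWeight f w) : IsSensitivityWeight (fun x => !f x) w where
  nonneg := h.nonneg
  sum_sq b := by
    rw [← h.sum_sq (!b)]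
    refine Finset.sum_congr rfl fun x _ => ?_
    cases f x <;> cases b <;> simp
  sum_sensitive := by
    rw [← h.sum_sensitive]
    simp

theorem IsSensitivityWeight.comp_equiv {f : (V → Bool) → Bool} {w : (V → Bool) → ℝ}
    (h : IsSensitivityWeight f w) (e : V ≃ W) :
    IsSensitivityWeight (fun x : W → Bool => f (x ∘ e)) fun x => w (x ∘ e) where
  nonneg _ := h.nonneg _
  sum_sq b := by
    rw [← h.sum_sq b]
    exact (e.symm.arrowCongr (Equiv.refl Bool)).sum_comp
      fun x => if f x = b then w x ^ 2 else 0
  sum_sensitive := by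
    rw [← Fintype.card_congr e, ← h.sum_sensitive,
      ← (e.symm.arrowCongr (Equiv.refl Bool)).sum_comp]
    refine Finset.sum_congr rfl fun x _ => ?_
    rw [← e.sum_comp]
    refine Finset.sum_congr rfl fun i _ => ?_
    have : (e.symm.arrowCongr (Equiv.refl Bool)) x = x ∘ e := rfl
    simp only [this, flipBit_comp_equiv]

/-- The weight for a conjunction: the product weight, rescaled where exactly one of the two
conjuncts holds, and zero where both fail. -/
noncomputable def andWeight (f : (V → Bool) → Bool) (g : (W → Bool) → Bool)
    (v : (V → Bool) → ℝ) (w : (W → Bool) → ℝ) (a b : ℝ) (s : V → Bool) (t : W → Bool) : ℝ :=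
  (if f s then (if g t then 1 else b) else (if g t then a else 0)) * (v s * w t)

theorem sum_arrow_sum (F : (V ⊕ W → Bool) → ℝ) :
    ∑ x, F x = ∑ s : V → Bool, ∑ t : W → Bool, F (Sum.elim s t) := by
  rw [← Fintype.sum_prod_type', ← (Equiv.sumArrowEquivProdArrow V W Bool).symm.sum_comp]
  rfl

/-- A sensitive edge of the conjunction moves one conjunct while the other is true, so the edge sum
is `a * 2√p + b * 2√q`. The false level set has squared norm `a² + b²`. -/
theorem IsSensitivityWeight.and [Nonempty V] {f : (V → Bool) → Bool} {g : (W → Bool) → Bool}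
    {v : (V → Bool) → ℝ} {w : (W → Bool) → ℝ}
    (hv : IsSensitivityWeight f v) (hw : IsSensitivityWeight g w) :
    ∃ u, IsSensitivityWeight
      (fun x : V ⊕ W → Bool => f (x ∘ Sum.inl) && g (x ∘ Sum.inr)) u := by
  set p : ℝ := (Fintype.card V : ℝ) with hp
  set q : ℝ := (Fintype.card W : ℝ) with hq
  have hp0 : 0 < p := by rw [hp]; exact_mod_cast Fintype.card_pos
  have hq0 : 0 ≤ q := by positivity
  -- By Cauchy–Schwarz this choice maximizes `a√p + b√q` subject to `a² + b² = 1`; the maximum is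
  -- `√(p + q)`.
  set a : ℝ := √p / √(p + q) with ha
  set b : ℝ := √q / √(p + q) with hb
  have hab : a ^ 2 + b ^ 2 = 1 := by
    rw [ha, hb, div_pow, div_pow, Real.sq_sqrt hp0.le, Real.sq_sqrt hq0,
      Real.sq_sqrt (by positivity)]
    field_simp
  have hval : a * √p + b * √q = √(p + q) := by
    have h : √(p + q) ≠ 0 := by positivity
    rw [ha, hb]
    field_simp
    rw [Real.sq_sqrt hp0.le, Real.sq_sqrt hq0, Real.sq_sqrt (by positivity)]
  have ha0 : 0 ≤ a := by positivity
  have hb0 : 0 ≤ b := by positivity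
  refine ⟨fun x => andWeight f g v w a b (x ∘ Sum.inl) (x ∘ Sum.inr), ⟨?_, ?_, ?_⟩⟩
  · intro x
    refine mul_nonneg ?_ (mul_nonneg (hv.nonneg _) (hw.nonneg _))
    split_ifs <;> simp [ha0, hb0]
  · intro c
    rw [sum_arrow_sum]
    simp only [Sum.elim_comp_inl, Sum.elim_comp_inr]
    cases c
    · calc _ = ∑ s, ∑ t, (a ^ 2 * ((if f s = false then v s ^ 2 else 0) *
              (if g t = true then w t ^ 2 else 0)) +
            b ^ 2 * ((if f s = true then v s ^ 2 else 0) *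
              (if g t = false then w t ^ 2 else 0))) := by
            refine Finset.sum_congr rfl fun s _ => Finset.sum_congr rfl fun t _ => ?_
            rcases Bool.eq_false_or_eq_true (f s) with hs | hs <;>
              rcases Bool.eq_false_or_eq_true (g t) with ht | ht <;>
              simp [andWeight, hs, ht, mul_pow]
        _ = 1 := by
            simp only [Finset.sum_add_distrib, ← Finset.mul_sum, ← Finset.sum_mul,
              hv.sum_sq, hw.sum_sq]
            linarith
    · calc _ = ∑ s, ∑ t, ((if f s = true then v s ^ 2 else 0) *
              (if g t = true then w t ^ 2 else 0)) := by
            refine Finset.sum_congr rfl fun s _ => Finset.sum_congr rfl fun t _ => ?_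
            rcases Bool.eq_false_or_eq_true (f s) with hs | hs <;>
              rcases Bool.eq_false_or_eq_true (g t) with ht | ht <;>
              simp [andWeight, hs, ht, mul_pow]
        _ = 1 := by
            simp only [← Finset.mul_sum, ← Finset.sum_mul, hv.sum_sq, hw.sum_sq]
            norm_num
  · rw [sum_arrow_sum]
    simp only [Fintype.sum_sum_type, flipBit_inl_elim, flipBit_inr_elim, Sum.elim_comp_inl,
      Sum.elim_comp_inr, Finset.sum_add_distrib]
    -- Of the two ends of such an edge, one has factor 1 and the other factor `a`.
    have h₁ : ∀ s t i, (if (f s && g t) ≠ (f (flipBit i s) && g t) then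
        andWeight f g v w a b s t * andWeight f g v w a b (flipBit i s) t else 0) =
        a * ((if f s ≠ f (flipBit i s) then v s * v (flipBit i s) else 0) *
          (if g t = true then w t ^ 2 else 0)) := by
      intro s t i
      cases hs : f s <;> cases hs' : f (flipBit i s) <;> cases ht : g t <;>
        simp [andWeight, hs, hs', ht] <;> ring
    have h₂ : ∀ s t i, (if (f s && g t) ≠ (f s && g (flipBit i t)) then
        andWeight f g v w a b s t * andWeight f g v w a b s (flipBit i t) else 0) =
        b * ((if f s = true then v s ^ 2 else 0) *
          (if g t ≠ g (flipBit i t) then w t * w (flipBit i t) else 0)) := by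
      intro s t i
      cases hs : f s <;> cases hs' : g (flipBit i t) <;> cases ht : g t <;>
        simp [andWeight, hs, hs', ht] <;> ring
    simp only [h₁, h₂, ← Finset.mul_sum, ← Finset.sum_mul]
    rw [hw.sum_sq, hv.sum_sq, hv.sum_sensitive, hw.sum_sensitive, Fintype.card_sum]
    push_cast
    rw [← hval]
    ring

/-- De Morgan reduces this to conjunction. -/
theorem IsSensitivityWeight.or [Nonempty V] {f : (V → Bool) → Bool} {g : (W → Bool) → Bool}
    {v : (V → Bool) → ℝ} {w : (W → Bool) → ℝ}
    (hv : IsSensitivityWeight f v) (hw : IsSensitivityWeight g w) :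
    ∃ u, IsSensitivityWeight
      (fun x : V ⊕ W → Bool => f (x ∘ Sum.inl) || g (x ∘ Sum.inr)) u := by
  obtain ⟨u, hu⟩ := hv.not.and hw.not
  exact ⟨u, by simpa using hu.not⟩

end Sensitivity

/-! ### Weights for read-once formulas -/

/-- The formula `φ` contains exactly the variables in `S`, and its function of these variables
has a sensitivity weight. -/
def Formula.HasWeightOn {n : ℕ} (φ : Formula n) (S : Finset (Fin n)) : Prop :=
  S.Nonempty ∧ (∀ i, i ∈ S ↔ φ.occurrences i ≠ 0) ∧
    ∃ f : (S → Bool) → Bool, (∀ x, φ.eval x = f fun i => x i) ∧ ∃ w, IsSensitivityWeight f w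

/-- A binary connective that preserves the existence of sensitivity weights for functions of
disjoint sets of variables does so for formulas. -/
theorem Formula.HasWeightOn.union {n : ℕ} {φ ψ χ : Formula n} {S T : Finset (Fin n)}
    (op : Bool → Bool → Bool)
    (hφ : φ.HasWeightOn S) (hψ : ψ.HasWeightOn T)
    (hχ : ∀ x, χ.eval x = op (φ.eval x) (ψ.eval x))
    (hocc : ∀ i, χ.occurrences i = φ.occurrences i + ψ.occurrences i)
    (hle : ∀ i, χ.occurrences i ≤ 1)
    (hop : ∀ (f : (S → Bool) → Bool) (g : (T → Bool) → Bool) v w, S.Nonempty →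
      IsSensitivityWeight f v → IsSensitivityWeight g w → ∃ u, IsSensitivityWeight
        (fun x : S ⊕ T → Bool => op (f (x ∘ Sum.inl)) (g (x ∘ Sum.inr))) u) :
    χ.HasWeightOn (S ∪ T) := by
  obtain ⟨hS, hS', f, hf, v, hv⟩ := hφ
  obtain ⟨-, hT', g, hg, w, hw⟩ := hψ
  have hd : Disjoint S T := by
    rw [Finset.disjoint_left]
    intro i hi hi'
    have := (hS' i).1 hi
    have := (hT' i).1 hi'
    have := hle i
    have := hocc i
    omega
  obtain ⟨u, hu⟩ := hop f g v w hS hv hw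
  refine ⟨hS.mono Finset.subset_union_left, fun i => ?_, _, fun x => ?_, _,
    hu.comp_equiv (Equiv.Finset.union S T hd)⟩
  · rw [Finset.mem_union, hS', hT', hocc]
    omega
  · rw [hχ, hf, hg]
    rfl

/-- The bound `≤ 1`, unlike `= 1`, passes to subformulas, which is what the induction needs. -/
theorem Formula.exists_hasWeightOn {n : ℕ} (φ : Formula n) (h : ∀ i, φ.occurrences i ≤ 1) :
    ∃ S, φ.HasWeightOn S := by
  induction φ with
  | var i =>
    refine ⟨{i}, by simp, fun j => ?_, _, fun x => ?_, _, isSensitivityWeight_proj⟩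
    · simp [Formula.occurrences, eq_comm]
    · exact congr_arg x (Finset.mem_singleton.1 (default : ({i} : Finset (Fin n))).2).symm
  | not φ ih =>
    obtain ⟨S, hS, hS', f, hf, w, hw⟩ := ih h
    exact ⟨S, hS, hS', _, fun x => by simp [Formula.eval, hf], w, hw.not⟩
  | and φ ψ ihφ ihψ =>
    obtain ⟨S, hS⟩ := ihφ fun i => (Nat.le_add_right _ _).trans (h i)
    obtain ⟨T, hT⟩ := ihψ fun i => (Nat.le_add_left _ _).trans (h i)
    refine ⟨_, hS.union (· && ·) hT (fun _ => rfl) (fun _ => rfl) h ?_⟩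
    intro f g v w hne hv hw
    have := hne.to_subtype
    exact hv.and hw
  | or φ ψ ihφ ihψ =>
    obtain ⟨S, hS⟩ := ihφ fun i => (Nat.le_add_right _ _).trans (h i)
    obtain ⟨T, hT⟩ := ihψ fun i => (Nat.le_add_left _ _).trans (h i)
    refine ⟨_, hS.union (· || ·) hT (fun _ => rfl) (fun _ => rfl) h ?_⟩
    intro f g v w hne hv hw
    have := hne.to_subtype
    exact hv.or hw

theorem IsReadOnce.exists_isSensitivityWeight {n : ℕ} {f : (Fin n → Bool) → Bool}
    (hf : IsReadOnce f) : ∃ w, IsSensitivityWeight f w := by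
  obtain ⟨φ, hocc, heval⟩ := hf
  obtain ⟨S, -, hS, g, hg, w, hw⟩ := φ.exists_hasWeightOn fun i => (hocc i).le
  have hmem : ∀ i, i ∈ S := fun i => by simp [hS, hocc]
  have hfg : f = fun x => g (x ∘ Equiv.subtypeUnivEquiv hmem) := by
    ext x
    rw [← heval, hg]
    rfl
  rw [hfg]
  exact ⟨_, hw.comp_equiv _⟩

end ReadOnce

namespace QuantumQuery

open ReadOnce

/-! ### The adversary bound for query algorithms -/

section Adversary

variable {n t : ℕ}

theorem norm_basisState {Z : Type u} (i : Fin (n + 1)) (z : Z) : ‖basisState n i z‖ = 1 := by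
  classical
  unfold basisState
  rw [PiLp.norm_single, lp.norm_single (by norm_num)]
  simp

theorem Algorithm.state_zero (A : Algorithm.{u} n t) (x : Fin n → Bool) :
    A.state x 0 = basisState n 0 A.start :=
  rfl

theorem Algorithm.state_succ (A : Algorithm.{u} n t) (x : Fin n → Bool) (l : Fin t) :
    A.state x l.succ = oracle A.Z x (A.U l (A.state x l.castSucc)) :=
  rfl

theorem Algorithm.norm_state (A : Algorithm.{u} n t) (x : Fin n → Bool) (l : Fin (t + 1)) :
    ‖A.state x l‖ = 1 := by
  induction l using Fin.induction with
  | zero => rw [A.state_zero, norm_basisState]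
  | succ l ih => rw [A.state_succ, LinearIsometryEquiv.norm_map, LinearIsometryEquiv.norm_map, ih]

/-- On two inputs that differ in one bit, a query changes the inner product of the states only
through the components that query this bit. -/
theorem re_inner_oracle_flipBit {Z : Type u} (x : Fin n → Bool) (i : Fin n)
    (ψ φ : WorkSpace n Z) :
    (inner ℂ (oracle Z x ψ) (oracle Z (flipBit i x) φ)).re =
      (inner ℂ ψ φ).re - 2 * (inner ℂ (ψ i.succ) (φ i.succ)).re := by
  have key : ∀ j : Fin (n + 1), inner ℂ (oracle Z x ψ j) (oracle Z (flipBit i x) φ j) =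
      inner ℂ (ψ j) (φ j) - if j = i.succ then 2 * inner ℂ (ψ j) (φ j) else 0 := by
    intro j
    rw [oracle_apply, oracle_apply]
    refine Fin.cases ?_ (fun k => ?_) j
    · simp [paddedInput, (Fin.succ_ne_zero i).symm]
    · by_cases hk : k = i
      · subst hk
        cases hx : x k <;> simp [paddedInput, flipBit, hx] <;> ring
      · cases hx : x k <;> simp [paddedInput, flipBit, hk, hx]
  rw [PiLp.inner_apply, PiLp.inner_apply, Finset.sum_congr rfl fun j _ => key j,
    Finset.sum_sub_distrib, Finset.sum_ite_eq' Finset.univ i.succ]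
  simp

theorem sum_norm_sq_succ_le {Z : Type u} (ψ : WorkSpace n Z) :
    ∑ i : Fin n, ‖ψ i.succ‖ ^ 2 ≤ ‖ψ‖ ^ 2 := by
  rw [PiLp.norm_sq_eq_of_L2, Fin.sum_univ_succ]
  exact le_add_of_nonneg_left (sq_nonneg _)

/-- The progress measure of the adversary argument: the sum of the real parts of the inner
products of the states over the sensitive edges of `f`, weighted by `w`. -/
noncomputable def progress {Z : Type u} (f : (Fin n → Bool) → Bool) (w : (Fin n → Bool) → ℝ)
    (ψ : (Fin n → Bool) → WorkSpace n Z) : ℝ :=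
  ∑ x, ∑ i, if f x ≠ f (flipBit i x) then
    w x * w (flipBit i x) * (inner ℂ (ψ x) (ψ (flipBit i x))).re else 0

theorem progress_isometry {Z : Type u} (f : (Fin n → Bool) → Bool) (w : (Fin n → Bool) → ℝ)
    (ψ : (Fin n → Bool) → WorkSpace n Z) (U : WorkSpace n Z ≃ₗᵢ[ℂ] WorkSpace n Z) :
    progress f w (fun x => U (ψ x)) = progress f w ψ := by
  simp [progress]

/-- An edge in direction `i` loses only through the components that query bit `i`.
Arithmetic–geometric mean splits this loss between the two ends, and the components of one state
have total squared norm at most that of the state. -/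
theorem progress_sub_le_progress_oracle {Z : Type u} {f : (Fin n → Bool) → Bool}
    {w : (Fin n → Bool) → ℝ} (hw : ∀ x, 0 ≤ w x) (ψ : (Fin n → Bool) → WorkSpace n Z) :
    progress f w ψ - 2 * ∑ x, w x ^ 2 * ‖ψ x‖ ^ 2 ≤
      progress f w fun x => oracle Z x (ψ x) := by
  have hswap : ∀ i : Fin n, ∑ x, w (flipBit i x) ^ 2 * ‖ψ (flipBit i x) i.succ‖ ^ 2 =
      ∑ x, w x ^ 2 * ‖ψ x i.succ‖ ^ 2 := fun i =>
    Equiv.sum_comp (Function.Involutive.toPerm (flipBit i) (flipBit_flipBit i))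
      fun x => w x ^ 2 * ‖ψ x i.succ‖ ^ 2
  have hedge : ∀ x i, (if f x ≠ f (flipBit i x) then
        w x * w (flipBit i x) * (inner ℂ (ψ x) (ψ (flipBit i x))).re else 0) ≤
      (if f x ≠ f (flipBit i x) then w x * w (flipBit i x) *
        (inner ℂ (oracle Z x (ψ x)) (oracle Z (flipBit i x) (ψ (flipBit i x)))).re else 0) +
      (w x ^ 2 * ‖ψ x i.succ‖ ^ 2 + w (flipBit i x) ^ 2 * ‖ψ (flipBit i x) i.succ‖ ^ 2) := by
    intro x i
    split_ifs
    · rw [re_inner_oracle_flipBit]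
      have h₁ : (inner ℂ (ψ x i.succ) (ψ (flipBit i x) i.succ)).re ≤
          ‖ψ x i.succ‖ * ‖ψ (flipBit i x) i.succ‖ := re_inner_le_norm (𝕜 := ℂ) _ _
      have h₂ := mul_le_mul_of_nonneg_left h₁ (mul_nonneg (hw x) (hw (flipBit i x)))
      nlinarith [sq_nonneg (w x * ‖ψ x i.succ‖ - w (flipBit i x) * ‖ψ (flipBit i x) i.succ‖)]
    · positivity
  have hsum := Finset.sum_le_sum fun x (_ : x ∈ Finset.univ) =>
    Finset.sum_le_sum fun i (_ : i ∈ Finset.univ) => hedge x i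
  simp only [Finset.sum_add_distrib] at hsum
  -- Flipping a fixed bit permutes the cube, so both ends contribute equally.
  have hcomm : ∑ x, ∑ i : Fin n, w (flipBit i x) ^ 2 * ‖ψ (flipBit i x) i.succ‖ ^ 2 =
      ∑ x, ∑ i : Fin n, w x ^ 2 * ‖ψ x i.succ‖ ^ 2 := by
    rw [Finset.sum_comm, Finset.sum_congr rfl fun i _ => hswap i, Finset.sum_comm]
  have hle : ∑ x, ∑ i : Fin n, w x ^ 2 * ‖ψ x i.succ‖ ^ 2 ≤ ∑ x, w x ^ 2 * ‖ψ x‖ ^ 2 := by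
    refine Finset.sum_le_sum fun x _ => ?_
    rw [← Finset.mul_sum]
    exact mul_le_mul_of_nonneg_left (sum_norm_sq_succ_le _) (sq_nonneg _)
  unfold progress
  linarith

/-- The 4 is twice the total squared weight 2, one unit from each level set. -/
theorem Algorithm.progress_state_ge (A : Algorithm.{u} n t) {f : (Fin n → Bool) → Bool}
    {w : (Fin n → Bool) → ℝ} (hw : IsSensitivityWeight f w) (l : Fin (t + 1)) :
    2 * √n - 4 * (l : ℕ) ≤ progress f w fun x => A.state x l := by
  induction l using Fin.induction with
  | zero =>
    have h := hw.sum_sensitive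
    rw [Fintype.card_fin] at h
    rw [← h]
    simp [progress, A.state_zero, inner_self_eq_norm_sq_to_K, norm_basisState]
  | succ l ih =>
    have h := progress_sub_le_progress_oracle (f := f) hw.nonneg
      fun x => A.U l (A.state x l.castSucc)
    simp only [LinearIsometryEquiv.norm_map, A.norm_state, one_pow, mul_one,
      hw.sum_sq_univ, progress_isometry f w (fun x => A.state x l.castSucc)] at h
    simp only [A.state_succ]
    rw [Fin.val_castSucc] at ih
    rw [Fin.val_succ]
    push_cast
    linarith

theorem inner_eq_add_of_isStarProjection {H : Type*} [NormedAddCommGroup H]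
    [InnerProductSpace ℂ H] [CompleteSpace H] {P Q : H →L[ℂ] H} (hP : IsStarProjection P)
    (hPQ : P + Q = 1) (ψ φ : H) :
    inner ℂ ψ φ = inner ℂ (P ψ) (P φ) + inner ℂ (Q ψ) (Q φ) := by
  have hproj : ∀ {R : H →L[ℂ] H}, IsStarProjection R →
      inner ℂ (R ψ) (R φ) = inner ℂ ψ (R φ) := by
    intro R hR
    have h₁ : R (R φ) = R φ := congr_arg (fun T : H →L[ℂ] H => T φ) hR.isIdempotentElem.eq
    have h₂ : ContinuousLinearMap.adjoint R = R := hR.isSelfAdjoint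
    rw [← ContinuousLinearMap.adjoint_inner_right, h₂, h₁]
  have hQ : IsStarProjection Q := by
    rw [eq_sub_of_add_eq' hPQ]
    exact hP.one_sub
  rw [hproj hP, hproj hQ, ← inner_add_right, ← add_apply, hPQ]
  rfl

theorem Algorithm.inner_eq_add (A : Algorithm.{u} n t) (ψ φ : WorkSpace n A.Z) (b : Bool) :
    inner ℂ ψ φ = inner ℂ (A.P b ψ) (A.P b φ) + inner ℂ (A.P (!b) ψ) (A.P (!b) φ) := by
  refine inner_eq_add_of_isStarProjection (A.isStarProjection_P b) ?_ ψ φ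
  cases b
  · exact A.P_false_add_P_true
  · exact (add_comm _ _).trans A.P_false_add_P_true

/-- Unit vectors of the plane that are close to different axes have a small inner product. -/
theorem mul_add_mul_le_of_sq_le {p₀ p₁ q₀ q₁ ε : ℝ} (hε : ε < 1 / 2)
    (hp₀ : 0 ≤ p₀) (hq₁ : 0 ≤ q₁)
    (hp : p₀ ^ 2 + p₁ ^ 2 = 1) (hq : q₀ ^ 2 + q₁ ^ 2 = 1) (hpε : p₁ ^ 2 ≤ ε) (hqε : q₀ ^ 2 ≤ ε) :
    p₀ * q₀ + p₁ * q₁ ≤ 1 - (√(1 - ε) - √ε) ^ 2 := by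
  have hd : √ε ≤ √(1 - ε) := Real.sqrt_le_sqrt (by linarith)
  have h₁ : √(1 - ε) ≤ p₀ := Real.sqrt_le_iff.2 ⟨hp₀, by linarith⟩
  have h₂ : √(1 - ε) ≤ q₁ := Real.sqrt_le_iff.2 ⟨hq₁, by linarith⟩
  have h₃ : p₁ ≤ √ε := Real.le_sqrt_of_sq_le hpε
  have h₄ : q₀ ≤ √ε := Real.le_sqrt_of_sq_le hqε
  -- For unit vectors the inner product is 1 minus half the squared distance; each coordinate
  -- contributes at least `(√(1-ε) - √ε)²` to that distance squared.
  have h₅ : (√(1 - ε) - √ε) ^ 2 ≤ (p₀ - q₀) ^ 2 :=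
    pow_le_pow_left₀ (by linarith) (by linarith) 2
  have h₆ : (√(1 - ε) - √ε) ^ 2 ≤ (q₁ - p₁) ^ 2 :=
    pow_le_pow_left₀ (by linarith) (by linarith) 2
  nlinarith

theorem Algorithm.norm_sq_add_norm_sq (A : Algorithm.{u} n t) (ψ : WorkSpace n A.Z) (b : Bool) :
    ‖A.P b ψ‖ ^ 2 + ‖A.P (!b) ψ‖ ^ 2 = ‖ψ‖ ^ 2 := by
  have h := congr_arg Complex.re (A.inner_eq_add ψ ψ b)
  simp only [inner_self_eq_norm_sq_to_K] at h
  norm_cast at h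
  exact h.symm

/-- An algorithm that computes `f` separates the inputs with different values of `f`. -/
theorem Algorithm.Computes.re_inner_state_le {A : Algorithm.{u} n t} {ε : ℝ}
    {f : (Fin n → Bool) → Bool} (hA : A.Computes ε f) (hε : ε < 1 / 2)
    {x y : Fin n → Bool} (hxy : f x ≠ f y) :
    (inner ℂ (A.state x (Fin.last t)) (A.state y (Fin.last t))).re ≤
      1 - (√(1 - ε) - √ε) ^ 2 := by
  set ψ := A.state x (Fin.last t) with hψ
  set φ := A.state y (Fin.last t) with hφ
  have hfy : f y = !f x := Bool.eq_not_of_ne hxy.symm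
  have hx : ‖A.P (!f x) ψ‖ ^ 2 ≤ ε := hA x
  have hy : ‖A.P (f x) φ‖ ^ 2 ≤ ε := by simpa [Algorithm.outputProb, hfy] using hA y
  have h₁ : (inner ℂ (A.P (f x) ψ) (A.P (f x) φ)).re ≤ ‖A.P (f x) ψ‖ * ‖A.P (f x) φ‖ :=
    re_inner_le_norm (𝕜 := ℂ) _ _
  have h₂ : (inner ℂ (A.P (!f x) ψ) (A.P (!f x) φ)).re ≤ ‖A.P (!f x) ψ‖ * ‖A.P (!f x) φ‖ :=
    re_inner_le_norm (𝕜 := ℂ) _ _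
  rw [A.inner_eq_add ψ φ (f x), Complex.add_re]
  refine (add_le_add h₁ h₂).trans ?_
  refine mul_add_mul_le_of_sq_le hε (norm_nonneg _) (norm_nonneg _) ?_ ?_ hx hy
  · rw [A.norm_sq_add_norm_sq, hψ, A.norm_state, one_pow]
  · rw [A.norm_sq_add_norm_sq, hφ, A.norm_state, one_pow]

/-- The adversary lower bound on the number of queries. -/
theorem Algorithm.Computes.mul_sqrt_le {A : Algorithm.{u} n t} {ε : ℝ}
    {f : (Fin n → Bool) → Bool} (hA : A.Computes ε f) (hε : ε < 1 / 2)
    {w : (Fin n → Bool) → ℝ} (hw : IsSensitivityWeight f w) :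
    (√(1 - ε) - √ε) ^ 2 / 2 * √n ≤ t := by
  have hlow := A.progress_state_ge hw (Fin.last t)
  have hup : (progress f w fun x => A.state x (Fin.last t)) ≤
      (2 * √n) * (1 - (√(1 - ε) - √ε) ^ 2) := by
    have h := hw.sum_sensitive
    rw [Fintype.card_fin] at h
    rw [← h, progress]
    simp only [Finset.sum_mul]
    refine Finset.sum_le_sum fun x _ => Finset.sum_le_sum fun i _ => ?_
    split_ifs with hx
    · exact mul_le_mul_of_nonneg_left (hA.re_inner_state_le hε hx)
        (mul_nonneg (hw.nonneg _) (hw.nonneg _))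
    · simp
  rw [Fin.val_last] at hlow
  linarith

end Adversary

end QuantumQuery

/-! ### The lower bound -/

theorem theorem2 (ε : ℝ) (hε₀ : 0 ≤ ε) (hε : ε < 1 / 2) :
    ∃ c : ℝ, 0 < c ∧
      ∀ (n : ℕ) (f : (Fin n → Bool) → Bool), ReadOnce.IsReadOnce f →
        ENNReal.ofReal (c * Real.sqrt n) ≤ (QuantumQuery.complexity.{u} ε f : ℝ≥0∞) := by
  have hlt : √ε < √(1 - ε) := Real.sqrt_lt_sqrt hε₀ (by linarith)
  refine ⟨(√(1 - ε) - √ε) ^ 2 / 2, by have := sub_pos.2 hlt; positivity, fun n f hf => ?_⟩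
  obtain ⟨w, hw⟩ := hf.exists_isSensitivityWeight
  set r := (√(1 - ε) - √ε) ^ 2 / 2 * √n
  -- Query counts are integers, so rounding the real bound up puts it in `ℕ∞`, where the infimum is
  -- taken.
  have hceil : ((⌈r⌉₊ : ℕ) : ℕ∞) ≤ QuantumQuery.complexity.{u} ε f :=
    le_iInf₂ fun t ⟨A, hA⟩ => by exact_mod_cast Nat.ceil_le.2 (hA.mul_sqrt_le hε hw)
  calc ENNReal.ofReal r ≤ ENNReal.ofReal (⌈r⌉₊ : ℕ) := ENNReal.ofReal_le_ofReal (Nat.le_ceil r)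
    _ = (((⌈r⌉₊ : ℕ) : ℕ∞) : ℝ≥0∞) := by simp
    _ ≤ _ := ENat.toENNReal_le.2 hceil
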